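/- Let $E$ be a real Banach lattice with order continuous norm, i.e. $x_\gamma\downarrow 0$ in $E$ implies $\|x_\gamma\|\to 0$ for every net $(x_\gamma)$. Let $E^*$ be the norm dual of $E$, which is a Banach lattice for the order $f\le g \iff f(x)\le g(x)$ for all $x\in E$ with $x\ge 0$. A net $(y_\alpha)$ in a Banach lattice $X$ is said to be *uaw-convergent* (unboundedly absolutely weakly convergent) to $y\in X$ if, for every $u\in X$ with $u\ge 0$, the net $|y_\alpha-y|\wedge u$ converges to $0$ in the weak topology $\sigma(X,X^*)$; it is *uaw-Cauchy* if the net $(y_\alpha-y_\beta)_{(\alpha,\beta)}$, indexed by pairs with the product order, is uaw-convergent to $0$. Then every norm bounded net in $E^*$ that is uaw-Cauchy (in the Banach lattice $X=E^*$) is $w^*$-convergent, that is, convergent in the topology $\sigma(E^*,E)$ to some element of $E^*$. -/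

import Mathlib

open Filter Topology

/-! ### The dual Banach lattice

For a real normed lattice `E`, the norm dual `StrongDual ℝ E` is ordered by the cone of positive
functionals; its lattice operations are given by the Riesz–Kantorovich formula
`f⁺ x = sup {f y | 0 ≤ y ≤ x}` for `0 ≤ x`. -/

namespace DualLattice

section

variable {E : Type*} [NormedAddCommGroup E] [NormedSpace ℝ E] [Lattice E]

/-- The values of `f` on the order interval `[0, x]` have supremum `posSup f x`. -/
noncomputable def posSup (f : StrongDual ℝ E) (x : E) : ℝ :=
  sSup (f '' Set.Icc 0 x)

variable [IsOrderedAddMonoid E] [HasSolidNorm E]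

theorem apply_le_bound (f : StrongDual ℝ E) {x y : E} (hy : y ∈ Set.Icc 0 x) :
    f y ≤ ‖f‖ * ‖x‖ := by
  have h1 : ‖y‖ ≤ ‖x‖ := HasSolidNorm.solid (by
    rw [abs_of_nonneg hy.1, abs_of_nonneg (hy.1.trans hy.2)]; exact hy.2)
  calc f y ≤ ‖f y‖ := Real.le_norm_self _
    _ ≤ ‖f‖ * ‖y‖ := f.le_opNorm y
    _ ≤ ‖f‖ * ‖x‖ := by gcongr

theorem bddAbove_image (f : StrongDual ℝ E) (x : E) : BddAbove (f '' Set.Icc 0 x) := by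
  refine ⟨‖f‖ * ‖x‖, ?_⟩
  rintro _ ⟨y, hy, rfl⟩
  exact apply_le_bound f hy

theorem apply_le_posSup (f : StrongDual ℝ E) {x y : E} (hy : y ∈ Set.Icc 0 x) :
    f y ≤ posSup f x :=
  le_csSup (bddAbove_image f x) ⟨y, hy, rfl⟩

theorem posSup_le (f : StrongDual ℝ E) {x : E} (hx : 0 ≤ x) {c : ℝ}
    (h : ∀ y ∈ Set.Icc 0 x, f y ≤ c) : posSup f x ≤ c := by
  refine csSup_le ⟨f 0, 0, ⟨le_rfl, hx⟩, rfl⟩ ?_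
  rintro _ ⟨y, hy, rfl⟩
  exact h y hy

theorem posSup_nonneg (f : StrongDual ℝ E) {x : E} (hx : 0 ≤ x) : 0 ≤ posSup f x := by
  simpa using apply_le_posSup f (x := x) (y := 0) ⟨le_rfl, hx⟩

theorem posSup_le_bound (f : StrongDual ℝ E) {x : E} (hx : 0 ≤ x) :
    posSup f x ≤ ‖f‖ * ‖x‖ :=
  posSup_le f hx fun _ hy => apply_le_bound f hy

theorem posSup_add (f : StrongDual ℝ E) {a b : E} (ha : 0 ≤ a) (hb : 0 ≤ b) :
    posSup f (a + b) = posSup f a + posSup f b := by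
  apply le_antisymm
  · refine posSup_le f (add_nonneg ha hb) fun y hy => ?_
    have h1 : y ⊓ a ∈ Set.Icc 0 a := ⟨le_inf hy.1 ha, inf_le_right⟩
    have h2 : y - y ⊓ a ∈ Set.Icc 0 b := by
      refine ⟨sub_nonneg.2 inf_le_left, ?_⟩
      rw [sub_le_comm]
      exact le_inf (sub_le_self y hb) (sub_le_iff_le_add.2 hy.2)
    have h3 : f y = f (y ⊓ a) + f (y - y ⊓ a) := by rw [← map_add]; simp
    rw [h3]
    exact add_le_add (apply_le_posSup f h1) (apply_le_posSup f h2)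
  · rw [← le_sub_iff_add_le]
    refine posSup_le f ha fun y hy => ?_
    rw [le_sub_comm]
    refine posSup_le f hb fun z hz => ?_
    rw [le_sub_iff_add_le, add_comm, ← map_add]
    exact apply_le_posSup f ⟨add_nonneg hy.1 hz.1, add_le_add hy.2 hz.2⟩

theorem posSup_sub_eq (f : StrongDual ℝ E) {a b : E} (ha : 0 ≤ a) (hb : 0 ≤ b) :
    posSup f (a - b)⁺ - posSup f (a - b)⁻ = posSup f a - posSup f b := by
  have h : (a - b)⁺ + b = a + (a - b)⁻ := by
    have := posPart_sub_negPart (a - b)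
    rw [sub_eq_sub_iff_add_eq_add] at this
    exact this
  have h' := congrArg (posSup f) h
  rw [posSup_add f (posPart_nonneg _) hb, posSup_add f ha (negPart_nonneg _)] at h'
  linarith

/-- `posSup f`, extended from the positive cone to an additive map on `E`. -/
noncomputable def posAddHom (f : StrongDual ℝ E) : E →+ ℝ :=
  AddMonoidHom.mk' (fun x => posSup f x⁺ - posSup f x⁻) fun x y => by
    have h : x + y = (x⁺ + y⁺) - (x⁻ + y⁻) := by
      conv_lhs => rw [← posPart_sub_negPart x, ← posPart_sub_negPart y]
      abel
    rw [h, posSup_sub_eq f (add_nonneg (posPart_nonneg x) (posPart_nonneg y))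
        (add_nonneg (negPart_nonneg x) (negPart_nonneg y)),
      posSup_add f (posPart_nonneg x) (posPart_nonneg y),
      posSup_add f (negPart_nonneg x) (negPart_nonneg y)]
    ring

theorem continuous_posAddHom (f : StrongDual ℝ E) : Continuous (posAddHom f) := by
  refine AddMonoidHomClass.continuous_of_bound (posAddHom f) ‖f‖ fun x => ?_
  have hp : ‖x⁺‖ ≤ ‖x‖ := HasSolidNorm.solid (by
    rw [abs_of_nonneg (posPart_nonneg x), ← posPart_add_negPart x]
    exact le_add_of_nonneg_right (negPart_nonneg x))
  have hn : ‖x⁻‖ ≤ ‖x‖ := HasSolidNorm.solid (by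
    rw [abs_of_nonneg (negPart_nonneg x), ← posPart_add_negPart x]
    exact le_add_of_nonneg_left (posPart_nonneg x))
  have h1 := posSup_nonneg f (posPart_nonneg x)
  have h2 := posSup_nonneg f (negPart_nonneg x)
  have h3 := (posSup_le_bound f (posPart_nonneg x)).trans
    (mul_le_mul_of_nonneg_left hp (norm_nonneg f))
  have h4 := (posSup_le_bound f (negPart_nonneg x)).trans
    (mul_le_mul_of_nonneg_left hn (norm_nonneg f))
  change |posSup f x⁺ - posSup f x⁻| ≤ _
  rw [abs_le]
  constructor <;> linarith

/-- The positive part of a bounded functional (Riesz–Kantorovich). -/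
noncomputable def pos (f : StrongDual ℝ E) : StrongDual ℝ E :=
  (posAddHom f).toRealLinearMap (continuous_posAddHom f)

theorem pos_apply (f : StrongDual ℝ E) {x : E} (hx : 0 ≤ x) :
    pos f x = sSup (f '' Set.Icc 0 x) := by
  have h0 : posSup f 0 = 0 := by
    have := posSup_add f (le_refl (0 : E)) le_rfl
    rw [add_zero] at this
    linarith
  change posSup f x⁺ - posSup f x⁻ = posSup f x
  rw [posPart_of_nonneg hx, negPart_of_nonneg hx, h0, sub_zero]

/-- The dual order: `f ≤ g` if and only if `f x ≤ g x` for all `x ≥ 0`. -/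
instance instPartialOrder : PartialOrder (StrongDual ℝ E) where
  le f g := ∀ x : E, 0 ≤ x → f x ≤ g x
  le_refl _ _ _ := le_rfl
  le_trans _ _ _ h1 h2 x hx := (h1 x hx).trans (h2 x hx)
  le_antisymm f g h1 h2 := by
    have h : ∀ x : E, 0 ≤ x → f x = g x := fun x hx => le_antisymm (h1 x hx) (h2 x hx)
    ext x
    rw [← posPart_sub_negPart x, map_sub, map_sub, h _ (posPart_nonneg x),
      h _ (negPart_nonneg x)]

theorem le_def {f g : StrongDual ℝ E} : f ≤ g ↔ ∀ x : E, 0 ≤ x → f x ≤ g x := Iff.rfl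

instance instIsOrderedAddMonoid : IsOrderedAddMonoid (StrongDual ℝ E) where
  add_le_add_left f g h k x hx := by
    simpa using h x hx

theorem le_pos (f : StrongDual ℝ E) : f ≤ pos f := fun x hx => by
  rw [pos_apply f hx]
  exact apply_le_posSup f ⟨hx, le_rfl⟩

theorem pos_nonneg (f : StrongDual ℝ E) : 0 ≤ pos f := fun x hx => by
  rw [pos_apply f hx]
  exact posSup_nonneg f hx

theorem pos_le {f g : StrongDual ℝ E} (hfg : f ≤ g) (hg : 0 ≤ g) : pos f ≤ g := fun x hx => by
  rw [pos_apply f hx]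
  refine posSup_le f hx fun y hy => (hfg y hy.1).trans ?_
  have h := hg (x - y) (sub_nonneg.2 hy.2)
  simpa using h

/-- The dual of a normed lattice is a lattice. -/
noncomputable instance instLattice : Lattice (StrongDual ℝ E) where
  toPartialOrder := instPartialOrder
  sup f g := g + pos (f - g)
  inf f g := f - pos (f - g)
  le_sup_left f g := sub_le_iff_le_add'.1 (le_pos (f - g))
  le_sup_right f g := le_add_of_nonneg_right (pos_nonneg (f - g))
  sup_le _ g _ hf hg :=
    le_sub_iff_add_le'.1 (pos_le (sub_le_sub_right hf g) (sub_nonneg.2 hg))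
  inf_le_left f g := sub_le_self f (pos_nonneg (f - g))
  inf_le_right f g := sub_le_comm.1 (le_pos (f - g))
  le_inf _ f _ hf hg :=
    le_sub_comm.1 (pos_le (sub_le_sub_left hg f) (sub_nonneg.2 hf))

end

end DualLattice

/-! ### Order continuity and unbounded absolute weak convergence -/

universe u

/-- The norm of `E` is order continuous: `x_α ↓ 0` implies `‖x_α‖ → 0` for every net `(x_α)`.
It makes no difference which universe the index sets are taken from, as long as it is at least that
of `E`, since a decreasing net can be re-indexed by its range. -/
def IsOrderContinuousNorm (E : Type u) [NormedAddCommGroup E] [Lattice E] : Prop :=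
  ∀ (ι : Type u) [Preorder ι] [IsDirectedOrder ι] [Nonempty ι] (x : ι → E),
    Antitone x → IsGLB (Set.range x) 0 → Tendsto (fun i => ‖x i‖) atTop (𝓝 0)

section

variable {X : Type*} [NormedAddCommGroup X] [NormedSpace ℝ X] [Lattice X]
  {ι : Type*} [Preorder ι]

/-- The net `x` is `uaw`-convergent to `a`: `|x_α - a| ∧ u → 0` weakly for every `u ≥ 0`. -/
def UawConverges (x : ι → X) (a : X) : Prop :=
  ∀ u : X, 0 ≤ u → Tendsto (fun i => toWeakSpace ℝ X (|x i - a| ⊓ u)) atTop (𝓝 0)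

/-- The net `x` is `uaw`-Cauchy: the net `(x_α - x_β)`, indexed by pairs `(α, β)`, is
`uaw`-convergent to `0`. -/
def UawCauchy (x : ι → X) : Prop :=
  UawConverges (fun p : ι × ι => x p.1 - x p.2) 0

end

/-! Fix `e ≥ 0`. The crux is `exists_pos_sub_apply_le`: one `u ≥ 0` in the dual makes `(f - u)⁺ e`
small for all positive `f` in a norm bounded set. As `|y| e = (|y| ⊓ u) e + (|y| - u)⁺ e`, and
uaw-convergence handles the first term (evaluation at `e` is a functional on the dual), a bounded
uaw-null net satisfies `|y_i| e → 0`. Applied to differences, this makes `x_i e` Cauchy in `ℝ`; the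
pointwise limit is bounded because the net is.

If no such `u` exists, an induction yields positive `f_n` and `y_n ∈ [0, e]` whose incompatibility
with order continuity is `not_forall_lt_sub_apply`. -/

theorem DualLattice.apply_mono {E : Type*} [NormedAddCommGroup E] [NormedSpace ℝ E] [Lattice E]
    [IsOrderedAddMonoid E] {f : StrongDual ℝ E} (hf : 0 ≤ f) {a b : E} (h : a ≤ b) :
    f a ≤ f b := by
  have := hf (b - a) (sub_nonneg.2 h)
  simpa using this

theorem DualLattice.apply_partialSups_le {E : Type*} [NormedAddCommGroup E]
    [NormedSpace ℝ E] [Lattice E] [IsOrderedAddMonoid E] {f : StrongDual ℝ E} (hf : 0 ≤ f)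
    {y : ℕ → E} (hy : ∀ n, 0 ≤ y n) (k : ℕ) :
    f (partialSups y k) ≤ ∑ j ∈ Finset.range (k + 1), f (y j) := by
  have h : partialSups y k ≤ ∑ j ∈ Finset.range (k + 1), y j :=
    partialSups_le _ _ _ fun j hj =>
      Finset.single_le_sum (fun i _ => hy i) (Finset.mem_range.2 (Nat.lt_succ_of_le hj))
  simpa using DualLattice.apply_mono hf h

/-! ### Order continuity and approximate order boundedness in the dual -/

namespace IsOrderContinuousNorm

section

variable {E : Type u} [NormedAddCommGroup E] [NormedSpace ℝ E] [Lattice E]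
  [IsOrderedAddMonoid E] [IsOrderedModule ℝ E] [HasSolidNorm E]

/-- The differences between the upper bounds and the terms of a bounded increasing sequence have
infimum zero. -/
theorem isGLB_upperBounds_sub {x : ℕ → E} (hb : BddAbove (Set.range x)) :
    IsGLB (Set.range fun p : (upperBounds (Set.range x))ᵒᵈ × ℕ =>
      (OrderDual.ofDual p.1).1 - x p.2) 0 := by
  refine ⟨?_, fun l hl => ?_⟩
  · rintro _ ⟨p, rfl⟩
    exact sub_nonneg.2 ((OrderDual.ofDual p.1).2 ⟨p.2, rfl⟩)
  · obtain ⟨e, he⟩ := hb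
    -- A lower bound `l` of all the differences can be subtracted from any upper bound, hence
    -- repeatedly; scaling by `1 / (k + 1)` then forces `l ≤ 0`.
    have step : ∀ k : ℕ, e - k • l ∈ upperBounds (Set.range x) := by
      intro k
      induction k with
      | zero => simpa using he
      | succ k ih =>
        rintro _ ⟨n, rfl⟩
        have h : l ≤ e - k • l - x n :=
          hl ⟨(OrderDual.toDual ⟨e - k • l, ih⟩, n), rfl⟩
        rw [le_sub_comm] at h
        rwa [succ_nsmul, ← sub_sub]
    have bound : ∀ k : ℕ, l ≤ ((k : ℝ) + 1)⁻¹ • (e - x 0) := by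
      intro k
      have h1 : x 0 ≤ e - (k + 1) • l := step (k + 1) ⟨0, rfl⟩
      rw [le_sub_comm] at h1
      have h2 := smul_le_smul_of_nonneg_left h1 (a := ((k : ℝ) + 1)⁻¹) (by positivity)
      rwa [← Nat.cast_smul_eq_nsmul ℝ, smul_smul, Nat.cast_add, Nat.cast_one,
        inv_mul_cancel₀ (by positivity), one_smul] at h2
    have lim : Tendsto (fun k : ℕ => ((k : ℝ) + 1)⁻¹ • (e - x 0)) atTop (𝓝 0) := by
      have h := (tendsto_one_div_add_atTop_nhds_zero_nat (𝕜 := ℝ)).smul_const (e - x 0)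
      simpa [one_div] using h
    exact ge_of_tendsto' lim bound

/-- In a Banach lattice with order continuous norm, bounded increasing sequences converge. -/
theorem exists_tendsto_of_monotone [CompleteSpace E] (hE : IsOrderContinuousNorm E) {x : ℕ → E}
    (hx : Monotone x) (hb : BddAbove (Set.range x)) : ∃ z, Tendsto x atTop (𝓝 z) := by
  have : Nonempty (upperBounds (Set.range x))ᵒᵈ := hb.to_subtype
  have : IsDirectedOrder ((upperBounds (Set.range x))ᵒᵈ × ℕ) := ⟨fun a b =>
    ⟨(OrderDual.toDual ⟨(OrderDual.ofDual a.1).1 ⊓ (OrderDual.ofDual b.1).1, fun y hy =>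
        le_inf ((OrderDual.ofDual a.1).2 hy) ((OrderDual.ofDual b.1).2 hy)⟩, max a.2 b.2),
      ⟨inf_le_left (a := (OrderDual.ofDual a.1).1), le_max_left _ _⟩,
      ⟨inf_le_right (a := (OrderDual.ofDual a.1).1), le_max_right _ _⟩⟩⟩
  have lim := hE ((upperBounds (Set.range x))ᵒᵈ × ℕ)
    (fun p => (OrderDual.ofDual p.1).1 - x p.2)
    (fun p q hpq => sub_le_sub hpq.1 (hx hpq.2)) (isGLB_upperBounds_sub hb)
  refine cauchySeq_tendsto_of_complete (Metric.cauchySeq_iff'.2 fun ε hε => ?_)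
  obtain ⟨⟨y, N⟩, hy⟩ := (lim.eventually_lt_const hε).exists
  refine ⟨N, fun n hn => ?_⟩
  rw [dist_eq_norm]
  refine lt_of_le_of_lt (HasSolidNorm.solid ?_) hy
  have h : x n ≤ (OrderDual.ofDual y).1 := (OrderDual.ofDual y).2 ⟨n, rfl⟩
  rw [abs_of_nonneg (sub_nonneg.2 (hx hn)), abs_of_nonneg (sub_nonneg.2 ((hx hn).trans h) :
    0 ≤ (OrderDual.ofDual y).1 - x N)]
  exact sub_le_sub_right h _

theorem exists_tendsto_of_antitone [CompleteSpace E] (hE : IsOrderContinuousNorm E) {x : ℕ → E}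
    (hx : Antitone x) (hb : BddBelow (Set.range x)) : ∃ z, Tendsto x atTop (𝓝 z) := by
  obtain ⟨b, hb⟩ := hb
  obtain ⟨z, hz⟩ := hE.exists_tendsto_of_monotone (x := fun n => -x n)
    (fun m n h => neg_le_neg (hx h)) ⟨-b, by
      rintro _ ⟨n, rfl⟩
      exact neg_le_neg (hb ⟨n, rfl⟩)⟩
  exact ⟨-z, by simpa using hz.neg⟩

/-- The tail suprema `z n = sup_{m ≥ n} y m` of a sequence in an order interval exist and converge
in norm to their infimum. -/
theorem exists_tail_sup [CompleteSpace E] (hE : IsOrderContinuousNorm E) {e : E} {y : ℕ → E}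
    (hy0 : ∀ n, 0 ≤ y n) (hye : ∀ n, y n ≤ e) :
    ∃ (z : ℕ → E) (w : E), Tendsto z atTop (𝓝 w) ∧ (∀ n, w ≤ z n) ∧ (∀ n, y n ≤ z n) ∧
      ∀ f : StrongDual ℝ E, 0 ≤ f → ∀ (n : ℕ) (B : ℝ),
        (∀ k, ∑ j ∈ Finset.range k, f (y (n + j)) ≤ B) → f (z n) ≤ B := by
  have hz : ∀ n, ∃ z, Tendsto (partialSups fun j => y (n + j)) atTop (𝓝 z) := fun n =>
    hE.exists_tendsto_of_monotone (partialSups_monotone _) ⟨e, by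
      rintro _ ⟨k, rfl⟩
      exact partialSups_le _ _ _ fun j _ => hye _⟩
  choose z hz using hz
  have hyz : ∀ n m, n ≤ m → y m ≤ z n := fun n m hnm => by
    refine ge_of_tendsto (hz n) ?_
    filter_upwards [eventually_ge_atTop (m - n)] with k hk
    have h := le_partialSups_of_le (fun j => y (n + j)) hk
    simpa [Nat.add_sub_cancel' hnm] using h
  have anti : Antitone z := fun n m hnm =>
    le_of_tendsto' (hz m) fun k => partialSups_le _ _ _ fun j _ => hyz n (m + j) (by omega)
  obtain ⟨w, hw⟩ := hE.exists_tendsto_of_antitone anti ⟨0, by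
    rintro _ ⟨n, rfl⟩
    exact (hy0 n).trans (hyz n n le_rfl)⟩
  refine ⟨z, w, hw, fun n => anti.le_of_tendsto hw n, fun n => hyz n n le_rfl,
    fun f hf n B hB => ?_⟩
  -- `z n` is a norm limit of finite suprema, each dominated by the sum of its nonnegative terms.
  exact le_of_tendsto' ((f.continuous.tendsto _).comp (hz n)) fun k =>
    (DualLattice.apply_partialSups_le hf (fun j => hy0 (n + j)) k).trans (hB (k + 1))

/-- The weight `2 ^ n` makes `f i (y n)` geometrically small for `i < n`, so every `f i` is `≤ 0` at
the limit `w` of the tail suprema `z n`. Then `ε < f n (y n) ≤ f n (z n) ≤ C * ‖z n - w‖ → 0`, which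
is absurd. -/
theorem not_forall_lt_sub_apply [CompleteSpace E] (hE : IsOrderContinuousNorm E) {e : E}
    {C ε : ℝ} (hC : 0 ≤ C) (hε : 0 < ε) {f : ℕ → StrongDual ℝ E} {y : ℕ → E}
    (hf : ∀ n, 0 ≤ f n) (hfC : ∀ n, ∀ x : E, 0 ≤ x → f n x ≤ C * ‖x‖)
    (hy0 : ∀ n, 0 ≤ y n) (hye : ∀ n, y n ≤ e) :
    ¬ ∀ n, ε < f n (y n) - 2 ^ n * ∑ i ∈ Finset.range n, f i (y n) := by
  intro h
  obtain ⟨z, w, hw, hwz, hyz, hfz⟩ := hE.exists_tail_sup hy0 hye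
  have he : 0 ≤ e := (hy0 0).trans (hye 0)
  set M := C * ‖e‖ with hM
  have hM0 : 0 ≤ M := by positivity
  have small : ∀ i n, i < n → f i (y n) ≤ M * (1 / 2) ^ n := by
    intro i n hin
    have h1 : f i (y n) ≤ ∑ i ∈ Finset.range n, f i (y n) :=
      Finset.single_le_sum (f := fun i => f i (y n)) (fun j _ => hf j _ (hy0 n))
        (Finset.mem_range.2 hin)
    have h2 : f n (y n) ≤ M := (DualLattice.apply_mono (hf n) (hye n)).trans (hfC n e he)
    have h3 := h n
    have h4 : 2 ^ n * f i (y n) ≤ M := by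
      have := mul_le_mul_of_nonneg_left h1 (show (0 : ℝ) ≤ 2 ^ n by positivity)
      linarith
    rw [one_div, inv_pow, ← div_eq_mul_inv, le_div_iff₀ (by positivity)]
    linarith
  have tail : ∀ i n, i < n → f i (z n) ≤ M * (1 / 2) ^ n * 2 := by
    intro i n hin
    refine hfz _ (hf i) n _ fun k => ?_
    calc ∑ j ∈ Finset.range k, f i (y (n + j))
        ≤ ∑ j ∈ Finset.range k, M * (1 / 2) ^ n * (1 / 2) ^ j :=
          Finset.sum_le_sum fun j _ => by
            rw [mul_assoc, ← pow_add]
            exact small i (n + j) (by omega)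
      _ = M * (1 / 2) ^ n * ∑ j ∈ Finset.range k, (1 / 2 : ℝ) ^ j := by rw [Finset.mul_sum]
      _ ≤ M * (1 / 2) ^ n * 2 := by
          gcongr
          exact sum_geometric_two_le k
  have zero : ∀ i, f i w ≤ 0 := by
    intro i
    have lim : Tendsto (fun n : ℕ => M * (1 / 2 : ℝ) ^ n * 2) atTop (𝓝 0) := by
      simpa using ((tendsto_pow_atTop_nhds_zero_of_lt_one (r := (1 / 2 : ℝ)) (by norm_num)
        (by norm_num)).const_mul M).mul_const 2
    refine ge_of_tendsto lim ?_
    filter_upwards [eventually_gt_atTop i] with n hn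
    exact (DualLattice.apply_mono (hf i) (hwz n)).trans (tail i n hn)
  have lim : Tendsto (fun n => C * ‖z n - w‖) atTop (𝓝 0) := by
    simpa using (tendsto_iff_norm_sub_tendsto_zero.1 hw).const_mul C
  obtain ⟨n, hn⟩ := (lim.eventually_lt_const hε).exists
  have h1 : ε < f n (y n) := by
    have h2 : 0 ≤ 2 ^ n * ∑ i ∈ Finset.range n, f i (y n) :=
      mul_nonneg (by positivity) (Finset.sum_nonneg fun i _ => hf i _ (hy0 n))
    linarith [h n]
  have h2 := DualLattice.apply_mono (hf n) (hyz n)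
  have h3 := hfC n (z n - w) (sub_nonneg.2 (hwz n))
  rw [map_sub] at h3
  linarith [zero n]

/-- For a Banach lattice with order continuous norm, bounded sets of positive functionals are
approximately order bounded with respect to the seminorm `f ↦ |f| e`. -/
theorem exists_pos_sub_apply_le [CompleteSpace E] (hE : IsOrderContinuousNorm E) {e : E}
    (he : 0 ≤ e) {C ε : ℝ} (hC : 0 ≤ C) (hε : 0 < ε) :
    ∃ u : StrongDual ℝ E, 0 ≤ u ∧ ∀ f : StrongDual ℝ E, 0 ≤ f →
      (∀ x : E, 0 ≤ x → f x ≤ C * ‖x‖) → DualLattice.pos (f - u) e ≤ ε := by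
  by_contra! H
  have H' : ∀ u : StrongDual ℝ E, 0 ≤ u → ∃ (f : StrongDual ℝ E) (y : E), 0 ≤ f ∧
      (∀ x : E, 0 ≤ x → f x ≤ C * ‖x‖) ∧ 0 ≤ y ∧ y ≤ e ∧ ε < f y - u y := by
    intro u hu
    obtain ⟨f, hf, hfC, h⟩ := H u hu
    rw [DualLattice.pos_apply _ he] at h
    obtain ⟨_, ⟨y, hy, rfl⟩, hlt⟩ := exists_lt_of_lt_csSup 
      (Set.Nonempty.image _ (Set.nonempty_Icc.2 he)) h
    exact ⟨f, y, hf, hfC, hy.1, hy.2, hlt⟩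
  choose! F Y hF hFC hY0 hYe hlt using H'
  -- `S n` sums the functionals already chosen; the next one is a counterexample to `u = 2 ^ n • S
  -- n`.
  let S : ℕ → StrongDual ℝ E := fun n => Nat.rec 0 (fun n s => s + F ((2 : ℝ) ^ n • s)) n
  have hS : ∀ n, S (n + 1) = S n + F ((2 : ℝ) ^ n • S n) := fun n => rfl
  have smul_nonneg' : ∀ (n : ℕ) {s : StrongDual ℝ E}, 0 ≤ s → 0 ≤ (2 : ℝ) ^ n • s :=
    fun n s hs x hx => mul_nonneg (by positivity) (hs x hx)
  have hS0 : ∀ n, 0 ≤ S n := by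
    intro n
    induction n with
    | zero => exact le_refl (0 : StrongDual ℝ E)
    | succ n ih => rw [hS]; exact add_nonneg ih (hF _ (smul_nonneg' n ih))
  have hU : ∀ n, 0 ≤ (2 : ℝ) ^ n • S n := fun n => smul_nonneg' n (hS0 n)
  have hSsum : ∀ n x, S n x = ∑ i ∈ Finset.range n, F ((2 : ℝ) ^ i • S i) x := by
    intro n x
    induction n with
    | zero => rfl
    | succ n ih => rw [hS, Finset.sum_range_succ, ← ih]; rfl
  refine hE.not_forall_lt_sub_apply hC hε (fun n => hF _ (hU n)) (fun n => hFC _ (hU n))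
    (fun n => hY0 _ (hU n)) (fun n => hYe _ (hU n)) fun n => ?_
  rw [← hSsum]
  exact hlt _ (hU n)

end

end IsOrderContinuousNorm

/-! ### From uaw-null nets to pointwise convergence -/

section

variable {E : Type*} [NormedAddCommGroup E] [NormedSpace ℝ E] [Lattice E]
  [IsOrderedAddMonoid E] [HasSolidNorm E]

theorem DualLattice.abs_apply_le (f : StrongDual ℝ E) {x : E} (hx : 0 ≤ x) :
    |f| x ≤ 3 * ‖f‖ * ‖x‖ := by
  -- The supremum in the dual unfolds to `|f| = -f + (2f)⁺`, whence the crude factor `1 + 2 = 3`.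
  change -f x + DualLattice.pos (f - -f) x ≤ _
  have h1 : DualLattice.pos (f - -f) x ≤ ‖f - -f‖ * ‖x‖ := by
    rw [DualLattice.pos_apply _ hx]
    exact DualLattice.posSup_le_bound _ hx
  have h2 : ‖f - -f‖ * ‖x‖ ≤ (‖f‖ + ‖f‖) * ‖x‖ := by
    gcongr
    simpa using norm_sub_le f (-f)
  have h3 := (neg_le_abs _).trans (f.le_opNorm x)
  linarith

theorem DualLattice.abs_apply_le_abs (f : StrongDual ℝ E) {x : E} (hx : 0 ≤ x) :
    |f x| ≤ |f| x :=
  abs_le'.2 ⟨le_abs_self f x hx, neg_le_abs f x hx⟩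

theorem WeakSpace.tendsto_apply_of_tendsto {X κ : Type*} [NormedAddCommGroup X] [NormedSpace ℝ X]
    {l : Filter κ} {g : κ → X} (h : Tendsto (fun i => toWeakSpace ℝ X (g i)) l (𝓝 0))
    (φ : StrongDual ℝ X) : Tendsto (fun i => φ (g i)) l (𝓝 0) := by
  have h1 := ((WeakBilin.eval_continuous (topDualPairing ℝ X).flip φ).tendsto 0).comp h
  have h0 : (topDualPairing ℝ X).flip 0 φ = 0 := map_zero φ
  rw [← h0]
  exact h1

/-- Norm bounded uaw-null nets in the dual of an order continuous Banach lattice are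
`|σ|(E*, E)`-null. -/
theorem UawConverges.tendsto_abs_apply [CompleteSpace E] [IsOrderedModule ℝ E]
    (hE : IsOrderContinuousNorm E) {κ : Type*} [Preorder κ] {y : κ → StrongDual ℝ E} {C : ℝ}
    (hC : ∀ i, ‖y i‖ ≤ C) (hy : UawConverges y 0) {e : E} (he : 0 ≤ e) :
    Tendsto (fun i => |y i| e) atTop (𝓝 0) := by
  rw [tendsto_order]
  refine ⟨fun a ha => Eventually.of_forall fun i =>
    ha.trans_le (abs_nonneg (y i) e he), fun ε hε => ?_⟩
  obtain hκ | ⟨⟨i₀⟩⟩ := isEmpty_or_nonempty κ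
  · exact Eventually.of_forall fun i => hκ.elim i
  have hC0 : 0 ≤ C := (norm_nonneg _).trans (hC i₀)
  obtain ⟨u, hu, h⟩ := hE.exists_pos_sub_apply_le he (C := 3 * C) (by positivity) (half_pos hε)
  have lim := WeakSpace.tendsto_apply_of_tendsto (hy u hu)
    (NormedSpace.inclusionInDoubleDual ℝ E e)
  filter_upwards [lim.eventually_lt_const (half_pos hε)] with i hi
  have h1 := h |y i| (abs_nonneg _) fun x hx =>
    (DualLattice.abs_apply_le (y i) hx).trans (by gcongr; exact hC i)
  have h2 : (|y i - 0| ⊓ u) e < ε / 2 := hi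
  rw [sub_zero] at h2
  have h3 : (|y i| ⊓ u) e = |y i| e - DualLattice.pos (|y i| - u) e := rfl
  linarith

end

theorem mainTheorem10 {E : Type*} [NormedAddCommGroup E] [NormedSpace ℝ E] [CompleteSpace E]
    [Lattice E] [IsOrderedAddMonoid E] [IsOrderedModule ℝ E] [HasSolidNorm E]
    (hE : IsOrderContinuousNorm E)
    {ι : Type*} [Preorder ι] [IsDirectedOrder ι] [Nonempty ι]
    (x : ι → StrongDual ℝ E) (hbdd : ∃ C : ℝ, ∀ i, ‖x i‖ ≤ C) (hx : UawCauchy x) :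
    ∃ f : StrongDual ℝ E,
      Tendsto (fun i => StrongDual.toWeakDual (x i)) atTop (𝓝 (StrongDual.toWeakDual f)) := by
  obtain ⟨C, hC⟩ := hbdd
  have cauchy : ∀ e : E, 0 ≤ e → ∃ c, Tendsto (fun i => x i e) atTop (𝓝 c) := by
    intro e he
    have hC2 : ∀ p : ι × ι, ‖x p.1 - x p.2‖ ≤ C + C := fun p =>
      (norm_sub_le _ _).trans (add_le_add (hC _) (hC _))
    have lim := hx.tendsto_abs_apply hE hC2 he
    refine cauchy_map_iff_exists_tendsto.1 (cauchy_map_iff'.2 ?_)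
    rw [tendsto_uniformity_iff_dist_tendsto_zero, prod_atTop_atTop_eq]
    refine squeeze_zero (fun p => dist_nonneg) (fun p => ?_) lim
    exact DualLattice.abs_apply_le_abs (x p.1 - x p.2) he
  have conv : ∀ e : E, ∃ c, Tendsto (fun i => x i e) atTop (𝓝 c) := by
    intro e
    obtain ⟨a, ha⟩ := cauchy e⁺ (posPart_nonneg e)
    obtain ⟨b, hb⟩ := cauchy e⁻ (negPart_nonneg e)
    refine ⟨a - b, (ha.sub hb).congr fun i => ?_⟩
    rw [← map_sub, posPart_sub_negPart]
  choose g hg using conv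
  let L : E →ₗ[ℝ] ℝ := linearMapOfTendsto g (fun i => (x i : E →ₗ[ℝ] ℝ)) (tendsto_pi_nhds.2 hg)
  have hL : ∀ e, ‖L e‖ ≤ C * ‖e‖ := fun e =>
    le_of_tendsto' (hg e).norm fun i => (x i).le_of_opNorm_le (hC i) e
  refine ⟨L.mkContinuous C hL, ?_⟩
  exact tendsto_iff_forall_eval_tendsto_topDualPairing.2 hg
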